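/- An \emph{ortholattice} is a bounded lattice $A$ with an order-inverting involution ${}^\perp$ satisfying $a\wedge a^\perp=0$ and $a\vee a^\perp=1$. A \emph{quantifier} on $A$ is a map $\exists\colon A\to A$ with $\exists(a\vee b)=\exists a\vee\exists b$, $\exists 0=0$, $\exists\exists a=\exists a$, $a\le\exists a$ and $\exists(\exists a)^\perp=(\exists a)^\perp$. Let $I$ be a set. A \emph{$\sigma$-free polyadic ortholattice} (over $I$) is an ortholattice $A$ with a family $(\nabla_J)_{J\subseteq I}$ of quantifiers on $A$ such that $\nabla_\emptyset a=a$ and $\nabla_{J\cup K}a=\nabla_J\nabla_K a$ for all non-empty $J,K\subseteq I$ and all $a\in A$; it is \emph{locally finite} if for every $a\in A$ there is a finite $J\subseteq I$ with $\nabla_{I\setminus J}a=a$. For a non-empty set $X$ and a complete ortholattice $C$, the \emph{full functional $\sigma$-free polyadic ortholattice} determined by $I$, $X$ and $C$ is the set $C^{X^I}$ of all functions $f\colon X^I\to C$ with the pointwise ortholattice operations and with $$\widehat{\nabla}_J f(\vec x)=\bigvee\{f(\vec y): \vec y\in X^I,\ \vec x(i)=\vec y(i)\text{ for all } i\in I\setminus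 J\}\qquad(J\subseteq I).$$ The functions $f\in C^{X^I}$ for which there is a finite $J\subseteq I$ such that $f(\vec x)=f(\vec y)$ whenever $\vec x(i)=\vec y(i)$ for all $i\in J$ form a subalgebra of it, the \emph{full functional locally finite $\sigma$-free polyadic ortholattice} determined by $I$, $X$ and $C$. A \emph{functional locally finite $\sigma$-free polyadic ortholattice} is a subalgebra of such an algebra, that is, a subset closed under $\wedge,\vee,{}^\perp,0,1$ and all $\widehat{\nabla}_J$. \textbf{Theorem.} Every locally finite $\sigma$-free polyadic ortholattice $\langle A,(\nabla_J)_{J\subseteq I}\rangle$ is isomorphic to a functional locally finite one: there are a complete ortholattice $C$, a non-empty set $X$, a subalgebra $S$ of the full functional locally finite $\sigma$-free polyadic ortholattice determined by $I$, $X$ and $C$, and a bijection $A\to S$ that preserves $\wedge,\vee,{}^\perp,0,1$ and carries $\nabla_J$ to the restriction of $\widehat{\nabla}_J$ for every $J\subseteq I$. -/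

import Mathlib

universe u v w

/-- An ortholattice: a bounded lattice with an order-inverting involutive complementation. -/
class Ortholattice (A : Type u) extends Lattice A, BoundedOrder A, Compl A where
  inf_compl_eq_bot' : ∀ a : A, a ⊓ aᶜ = ⊥
  sup_compl_eq_top' : ∀ a : A, a ⊔ aᶜ = ⊤
  compl_anti' : ∀ a b : A, a ≤ b → bᶜ ≤ aᶜ
  compl_compl_eq' : ∀ a : A, aᶜᶜ = a

/-- An ortholattice whose lattice reduct is complete. -/
class CompleteOrtholattice (A : Type u) extends CompleteLattice A, Ortholattice A

/-- Function spaces carry the pointwise ortholattice structure. -/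
instance Pi.instOrtholattice {ι : Type v} {A : Type u} [Ortholattice A] :
    Ortholattice (ι → A) where
  inf_compl_eq_bot' f := funext fun x => Ortholattice.inf_compl_eq_bot' (f x)
  sup_compl_eq_top' f := funext fun x => Ortholattice.sup_compl_eq_top' (f x)
  compl_anti' f g h := fun x => Ortholattice.compl_anti' (f x) (g x) (h x)
  compl_compl_eq' f := funext fun x => Ortholattice.compl_compl_eq' (f x)

namespace Ortholattice

/-- A quantifier on an ortholattice. -/
structure IsQuantifier {A : Type u} [Ortholattice A] (q : A → A) : Prop where
  map_sup : ∀ a b, q (a ⊔ b) = q a ⊔ q b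
  map_bot : q ⊥ = ⊥
  idem : ∀ a, q (q a) = q a
  le_self : ∀ a, a ≤ q a
  map_compl : ∀ a, q (q a)ᶜ = (q a)ᶜ

/-- A `σ`-free polyadic structure on the ortholattice `A`, with set of variables `I`:
a family of quantifiers `∇ J`, one for each subset `J` of `I`. -/
structure Polyadic (I : Type v) (A : Type u) [Ortholattice A] where
  nabla : Set I → A → A
  isQuantifier : ∀ J, IsQuantifier (nabla J)
  nabla_empty : ∀ a, nabla ∅ a = a
  nabla_union : ∀ J K : Set I, J.Nonempty → K.Nonempty →
    ∀ a, nabla (J ∪ K) a = nabla J (nabla K a)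

namespace Polyadic

variable {I : Type v} {A : Type u} [Ortholattice A]

/-- `J` is a support of `a`. -/
def IsSupport (P : Polyadic I A) (J : Set I) (a : A) : Prop :=
  P.nabla Jᶜ a = a

/-- Every element has a finite support. -/
def LocallyFinite (P : Polyadic I A) : Prop :=
  ∀ a : A, ∃ J : Set I, J.Finite ∧ P.IsSupport J a

/-- Isomorphisms of `σ`-free polyadic ortholattices over the same set of variables. -/
structure Iso {B : Type w} [Ortholattice B] (P : Polyadic I A) (Q : Polyadic I B)
    extends A ≃ B where
  map_inf : ∀ a b, toFun (a ⊓ b) = toFun a ⊓ toFun b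
  map_sup : ∀ a b, toFun (a ⊔ b) = toFun a ⊔ toFun b
  map_compl : ∀ a, toFun aᶜ = (toFun a)ᶜ
  map_bot : toFun ⊥ = ⊥
  map_top : toFun ⊤ = ⊤
  map_nabla : ∀ J a, toFun (P.nabla J a) = Q.nabla J (toFun a)

/-- Subalgebras: subsets closed under all the operations. -/
structure Subalg (P : Polyadic I A) where
  carrier : Set A
  inf_mem : ∀ {a b}, a ∈ carrier → b ∈ carrier → a ⊓ b ∈ carrier
  sup_mem : ∀ {a b}, a ∈ carrier → b ∈ carrier → a ⊔ b ∈ carrier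
  compl_mem : ∀ {a}, a ∈ carrier → aᶜ ∈ carrier
  bot_mem : ⊥ ∈ carrier
  top_mem : ⊤ ∈ carrier
  nabla_mem : ∀ (J : Set I) {a}, a ∈ carrier → P.nabla J a ∈ carrier

/-- The underlying type of a subalgebra. -/
def Subalg.Elem {P : Polyadic I A} (S : Subalg P) : Type u := {a : A // a ∈ S.carrier}

/-- The ortholattice structure of a subalgebra, with the restricted operations and order. -/
instance Subalg.instOrtholattice {P : Polyadic I A} (S : Subalg P) : Ortholattice S.Elem where
  le a b := a.1 ≤ b.1
  le_refl a := le_refl a.1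
  le_trans a b c := le_trans (a := a.1) (b := b.1) (c := c.1)
  le_antisymm _ _ h k := Subtype.ext (le_antisymm h k)
  inf a b := ⟨a.1 ⊓ b.1, S.inf_mem a.2 b.2⟩
  sup a b := ⟨a.1 ⊔ b.1, S.sup_mem a.2 b.2⟩
  inf_le_left a b := inf_le_left (a := a.1) (b := b.1)
  inf_le_right a b := inf_le_right (a := a.1) (b := b.1)
  le_inf a b c h k := _root_.le_inf (show a.1 ≤ b.1 from h) (show a.1 ≤ c.1 from k)
  le_sup_left a b := le_sup_left (a := a.1) (b := b.1)
  le_sup_right a b := le_sup_right (a := a.1) (b := b.1)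
  sup_le a b c := sup_le (a := a.1) (b := b.1) (c := c.1)
  bot := ⟨⊥, S.bot_mem⟩
  top := ⟨⊤, S.top_mem⟩
  bot_le a := bot_le (a := a.1)
  le_top a := le_top (a := a.1)
  compl a := ⟨a.1ᶜ, S.compl_mem a.2⟩
  inf_compl_eq_bot' a := Subtype.ext (inf_compl_eq_bot' a.1)
  sup_compl_eq_top' a := Subtype.ext (sup_compl_eq_top' a.1)
  compl_anti' a b := compl_anti' a.1 b.1
  compl_compl_eq' a := Subtype.ext (compl_compl_eq' a.1)

/-- A subalgebra, as a `σ`-free polyadic ortholattice with the restricted quantifiers. -/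
def Subalg.toPolyadic {P : Polyadic I A} (S : Subalg P) : Polyadic I S.Elem where
  nabla J a := ⟨P.nabla J a.1, S.nabla_mem J a.2⟩
  isQuantifier J :=
    { map_sup := fun a b => Subtype.ext ((P.isQuantifier J).map_sup a.1 b.1)
      map_bot := Subtype.ext (P.isQuantifier J).map_bot
      idem := fun a => Subtype.ext ((P.isQuantifier J).idem a.1)
      le_self := fun a => (P.isQuantifier J).le_self a.1
      map_compl := fun a => Subtype.ext ((P.isQuantifier J).map_compl a.1) }
  nabla_empty a := Subtype.ext (P.nabla_empty a.1)
  nabla_union J K hJ hK a := Subtype.ext (P.nabla_union J K hJ hK a.1)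

end Polyadic

/-- `y` is a `J`-variant of `x`: the two points agree at every index outside `J`. -/
def JVariant {I : Type v} {X : Type w} (J : Set I) (x y : I → X) : Prop :=
  ∀ i, i ∉ J → x i = y i

section full

variable (I : Type v) (X : Type w) (C : Type u) [CompleteOrtholattice C]

/-- The functional quantifier: the join of the values of `f` over all `J`-variants of `x`. -/
def funNabla {I : Type v} {X : Type w} {C : Type u} [CompleteOrtholattice C]
    (J : Set I) (f : (I → X) → C) : (I → X) → C :=
  fun x => sSup {c | ∃ y, JVariant J x y ∧ c = f y}

theorem le_funNabla {I : Type v} {X : Type w} {C : Type u} [CompleteOrtholattice C]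
    {J : Set I} (f : (I → X) → C) {x y : I → X} (h : JVariant J x y) :
    f y ≤ funNabla J f x :=
  le_sSup ⟨y, h, rfl⟩

theorem funNabla_le {I : Type v} {X : Type w} {C : Type u} [CompleteOrtholattice C]
    {J : Set I} {f : (I → X) → C} {x : I → X} {c : C}
    (h : ∀ y, JVariant J x y → f y ≤ c) : funNabla J f x ≤ c :=
  sSup_le (by rintro _ ⟨y, hy, rfl⟩; exact h y hy)

theorem funNabla_of_const {I : Type v} {X : Type w} {C : Type u} [CompleteOrtholattice C]
    {J : Set I} {f : (I → X) → C} (h : ∀ x y, JVariant J x y → f x = f y) :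
    funNabla J f = f :=
  funext fun x => le_antisymm (funNabla_le fun y hy => (h x y hy).ge)
    (le_funNabla f fun _ _ => rfl)

theorem funNabla_congr {I : Type v} {X : Type w} {C : Type u} [CompleteOrtholattice C]
    (J : Set I) (f : (I → X) → C) {x y : I → X} (h : JVariant J x y) :
    funNabla J f x = funNabla J f y :=
  le_antisymm
    (funNabla_le fun _ hz => le_funNabla f fun i hi => (h i hi).symm.trans (hz i hi))
    (funNabla_le fun _ hz => le_funNabla f fun i hi => (h i hi).trans (hz i hi))

/-- The full functional `σ`-free polyadic ortholattice determined by `I`, `X` and `C`: all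
functions from `I → X` to `C`, with the pointwise ortholattice operations. -/
def fullFunctional : Polyadic I ((I → X) → C) where
  nabla := funNabla
  isQuantifier J :=
    { map_sup := fun f g => funext fun x => le_antisymm
        (funNabla_le fun _ hy => sup_le_sup (le_funNabla f hy) (le_funNabla g hy))
        (sup_le (funNabla_le fun _ hy => le_sup_left.trans (le_funNabla (f ⊔ g) hy))
          (funNabla_le fun _ hy => le_sup_right.trans (le_funNabla (f ⊔ g) hy)))
      map_bot := funNabla_of_const fun _ _ _ => rfl
      idem := fun f => funNabla_of_const fun _ _ h => funNabla_congr J f h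
      le_self := fun f _ => le_funNabla f fun _ _ => rfl
      map_compl := fun f => funNabla_of_const fun _ _ h =>
        congrArg (fun c : C => cᶜ) (funNabla_congr J f h) }
  nabla_empty f := funNabla_of_const fun _ _ h =>
    congrArg f (funext fun i => h i (Set.notMem_empty i))
  nabla_union J K _ _ f := by
    classical
    funext x
    apply le_antisymm
    · refine funNabla_le fun y hy => ?_
      have h1 : JVariant J x (fun i => if i ∈ J then y i else x i) := by
        intro i hi; simp [hi]
      have h2 : JVariant K (fun i => if i ∈ J then y i else x i) y := by
        intro i hi
        by_cases hJ : i ∈ J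
        · simp [hJ]
        · simpa [hJ] using hy i (by simp [hi, hJ])
      exact (le_funNabla f h2).trans (le_funNabla (funNabla K f) h1)
    · refine funNabla_le fun y hy => funNabla_le fun z hz => le_funNabla f fun i hi => ?_
      rw [Set.mem_union, not_or] at hi
      exact (hy i hi.1).trans (hz i hi.2)

/-- `f` is independent of `J`: it takes equal values at points that are `J`-variants. -/
def IndependentOf {I : Type v} {X : Type w} {C : Type u} (f : (I → X) → C) (J : Set I) : Prop :=
  ∀ x y, JVariant J x y → f x = f y

/-- The full functional locally finite `σ`-free polyadic ortholattice determined by `I`, `X` and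
`C`: the subalgebra of the full functional one that consists of all functions that are independent
of the complement of some finite set of variables. -/
def fullLocallyFinite : (fullFunctional I X C).Subalg where
  carrier := {f | ∃ J : Set I, J.Finite ∧ IndependentOf f Jᶜ}
  inf_mem := by
    rintro f g ⟨J, hJ, hf⟩ ⟨K, hK, hg⟩
    refine ⟨J ∪ K, hJ.union hK, fun x y h => ?_⟩
    have h1 := hf x y fun i hi => h i fun hu => hu (Or.inl (not_not.mp hi))
    have h2 := hg x y fun i hi => h i fun hu => hu (Or.inr (not_not.mp hi))
    simp only [Pi.inf_apply, h1, h2]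
  sup_mem := by
    rintro f g ⟨J, hJ, hf⟩ ⟨K, hK, hg⟩
    refine ⟨J ∪ K, hJ.union hK, fun x y h => ?_⟩
    have h1 := hf x y fun i hi => h i fun hu => hu (Or.inl (not_not.mp hi))
    have h2 := hg x y fun i hi => h i fun hu => hu (Or.inr (not_not.mp hi))
    simp only [Pi.sup_apply, h1, h2]
  compl_mem := by
    rintro f ⟨J, hJ, hf⟩
    exact ⟨J, hJ, fun x y h => congrArg (fun c : C => cᶜ) (hf x y h)⟩
  bot_mem := ⟨∅, Set.finite_empty, fun _ _ _ => rfl⟩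
  top_mem := ⟨∅, Set.finite_empty, fun _ _ _ => rfl⟩
  nabla_mem := by
    classical
    rintro K f ⟨J, hJ, hf⟩
    have key : ∀ x y, JVariant Jᶜ x y → funNabla K f x ≤ funNabla K f y := by
      intro x y h
      refine funNabla_le fun z hz => ?_
      have h1 : JVariant K y (fun i => if i ∈ K then z i else y i) := by
        intro i hi; simp [hi]
      have h2 : f z = f (fun i => if i ∈ K then z i else y i) := by
        apply hf
        intro i hi
        by_cases hK : i ∈ K
        · simp [hK]
        · simpa [hK] using (hz i hK).symm.trans (h i hi)
      exact h2.le.trans (le_funNabla f h1)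
    exact ⟨J, hJ, fun x y h => le_antisymm (key x y h) (key y x fun i hi => (h i hi).symm)⟩

end full

end Ortholattice

namespace Ortholattice

/-! ### Ortholattice and quantifier preliminaries -/

section Basic

variable {A : Type u} [Ortholattice A]

/-! Take a copy of `A` for each point `x : I → X` and call `(x, a)` orthogonal to `(y, b)` when `∇
{i | x i ≠ y i} a ≤ bᶜ`. The biorthogonally closed sets form a complete ortholattice `C`, and `a`
goes to the function sending `x` to the closed set generated by `(x, a)`. Everything rests on
`Orthogonal.trans`, which makes each copy embed in `C`, and on `orthogonal_nabla_iff`, which turns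
`∇ J` into a join over `J`-variants. The latter needs only that `X` has two points. Local finiteness
serves only to place the image among functions depending on finitely many variables. -/

theorem le_compl_comm' {a b : A} (h : a ≤ bᶜ) : b ≤ aᶜ :=
  (compl_compl_eq' b).ge.trans (compl_anti' _ _ h)

theorem eq_bot_of_le_compl {a b : A} (h : a ≤ b) (h' : a ≤ bᶜ) : a = ⊥ :=
  le_bot_iff.mp ((le_inf h h').trans (inf_compl_eq_bot' b).le)

theorem le_compl_sup_iff {a b c : A} : c ≤ (a ⊔ b)ᶜ ↔ c ≤ aᶜ ∧ c ≤ bᶜ := by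
  refine ⟨fun h => ⟨h.trans (compl_anti' _ _ le_sup_left),
    h.trans (compl_anti' _ _ le_sup_right)⟩, fun h => le_compl_comm' ?_⟩
  exact sup_le (le_compl_comm' h.1) (le_compl_comm' h.2)

theorem compl_sup' (a b : A) : (a ⊔ b)ᶜ = aᶜ ⊓ bᶜ :=
  eq_of_forall_le_iff fun c => by rw [le_compl_sup_iff, le_inf_iff]

theorem compl_bot' : (⊥ : A)ᶜ = ⊤ :=
  top_le_iff.mp (le_compl_comm' bot_le)

theorem inf_eq_compl_sup (a b : A) : a ⊓ b = (aᶜ ⊔ bᶜ)ᶜ := by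
  rw [compl_sup', compl_compl_eq', compl_compl_eq']

theorem IsQuantifier.monotone {q : A → A} (hq : IsQuantifier q) : Monotone q := fun a b h => by
  rw [← sup_eq_right.mpr h, hq.map_sup]
  exact le_sup_left

/-- Since `(q a)ᶜ` is fixed by `q` and lies above `b`, it lies above `q b`. This is what makes
orthogonality symmetric. -/
theorem IsQuantifier.le_compl_comm {q : A → A} (hq : IsQuantifier q) {a b : A}
    (h : q a ≤ bᶜ) : q b ≤ aᶜ :=
  (hq.monotone (le_compl_comm' h)).trans
    ((hq.map_compl a).le.trans (compl_anti' _ _ (hq.le_self a)))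

end Basic

/-! ### Complete ortholattices from orthogonality relations -/

section ConceptOrtholattice

variable {Y : Type u} {r : Y → Y → Prop}

/-- The complete ortholattice of biorthogonally closed subsets for an orthogonality relation in
which every self-orthogonal point is orthogonal to all points. -/
abbrev conceptOrtholattice (hs : ∀ p q, r p q → r q p) (hr : ∀ p, r p p → ∀ q, r p q) :
    CompleteOrtholattice (Concept Y Y r) where
  compl c :=
    { extent := c.intent
      intent := c.extent
      upperPolar_extent := by
        rw [← c.lowerPolar_intent]
        exact Set.ext fun p => ⟨fun h q hq => hs _ _ (h hq), fun h q hq => hs _ _ (h hq)⟩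
      lowerPolar_intent := by
        rw [← c.upperPolar_extent]
        exact Set.ext fun p => ⟨fun h q hq => hs _ _ (h hq), fun h q hq => hs _ _ (h hq)⟩ }
  inf_compl_eq_bot' c := by
    refine le_bot_iff.mp fun p hp => ?_
    -- The bottom concept consists of the points orthogonal to everything; `p`, in both extent and
    -- intent, is self-orthogonal.
    change p ∈ lowerPolar r Set.univ
    exact fun q _ => hr p (Concept.rel_extent_intent hp.1 hp.2) q
  sup_compl_eq_top' c := by
    refine top_le_iff.mp (Concept.intent_subset_intent_iff.mp fun p hp => ?_)
    change p ∈ upperPolar r Set.univ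
    exact fun q _ => hs _ _ (hr p (Concept.rel_extent_intent hp.2 hp.1) q)
  compl_anti' _ _ h := Concept.intent_subset_intent_iff.mpr h
  compl_compl_eq' _ := rfl

end ConceptOrtholattice

namespace Polyadic

/-! ### Orthogonality between the copies of `A` -/

variable {I : Type v} {A : Type u} [Ortholattice A] (P : Polyadic I A)

theorem nabla_union' (J K : Set I) (a : A) :
    P.nabla (J ∪ K) a = P.nabla J (P.nabla K a) := by
  rcases J.eq_empty_or_nonempty with rfl | hJ
  · rw [Set.empty_union, P.nabla_empty]
  rcases K.eq_empty_or_nonempty with rfl | hK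
  · rw [Set.union_empty, P.nabla_empty]
  exact P.nabla_union J K hJ hK a

theorem nabla_mono_set {J K : Set I} (h : J ⊆ K) (a : A) : P.nabla J a ≤ P.nabla K a := by
  rw [← Set.union_eq_left.mpr h, nabla_union']
  exact (P.isQuantifier K).le_self _

variable (X : Type w)

/-- The orthogonality relation on the copies of `A` indexed by `I → X`. The copies indexed by `x`
and `y` are glued along the elements fixed by `∇ {i | x i ≠ y i}`. -/
def Orthogonal (p q : (I → X) × A) : Prop :=
  P.nabla {i | p.1 i ≠ q.1 i} p.2 ≤ q.2ᶜ

variable {X} {P}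

theorem Orthogonal.symm {p q : (I → X) × A} (h : P.Orthogonal X p q) : P.Orthogonal X q p := by
  have := (P.isQuantifier _).le_compl_comm h
  simpa only [Orthogonal, ne_comm] using this

theorem orthogonal_same {x : I → X} {a b : A} : P.Orthogonal X (x, a) (x, b) ↔ a ≤ bᶜ := by
  simp [Orthogonal, P.nabla_empty]

/-- An index where `p` and `q` differ is one where `p` differs from `y` or `y` from `q`, so
composing the two quantifiers dominates the one needed. -/
theorem Orthogonal.trans {p q : (I → X) × A} {y : I → X} {b : A}
    (h : P.Orthogonal X p (y, bᶜ)) (h' : P.Orthogonal X (y, b) q) : P.Orthogonal X p q := by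
  simp only [Orthogonal, compl_compl_eq'] at h h' ⊢
  refine le_trans ?_ (((P.isQuantifier _).monotone h).trans h')
  rw [← nabla_union']
  refine P.nabla_mono_set (fun i hi => ?_) _
  by_contra hc
  simp only [Set.mem_union, Set.mem_ofPred_eq, not_or, not_not] at hc
  exact hi (hc.2.trans hc.1)

theorem Orthogonal.of_self {p : (I → X) × A} (h : P.Orthogonal X p p) (q : (I → X) × A) :
    P.Orthogonal X p q := by
  obtain ⟨x, a⟩ := p
  rw [orthogonal_same] at h
  obtain rfl := eq_bot_of_le_compl le_rfl h
  exact (P.isQuantifier _).map_bot.le.trans bot_le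

/-- Points orthogonal to `(x, a)` and to `(x, aᶜ)` are thus polars of each other: the second
condition is tested at `q = (x, aᶜ)`. -/
theorem orthogonal_compl_iff {p : (I → X) × A} {x : I → X} {a : A} :
    P.Orthogonal X p (x, aᶜ) ↔ ∀ q, P.Orthogonal X q (x, a) → P.Orthogonal X p q :=
  ⟨fun h _ hq => h.trans hq.symm,
    fun h => h _ (orthogonal_same.mpr le_rfl)⟩

theorem orthogonal_sup_iff {p : (I → X) × A} {x : I → X} {a b : A} :
    P.Orthogonal X p (x, a ⊔ b) ↔ P.Orthogonal X p (x, a) ∧ P.Orthogonal X p (x, b) :=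
  le_compl_sup_iff

theorem orthogonal_nabla_iff [Nontrivial X] {J : Set I} {p : (I → X) × A} {x : I → X} {a : A} :
    P.Orthogonal X p (x, P.nabla J a) ↔ ∀ y, JVariant J x y → P.Orthogonal X p (y, a) := by
  classical
  constructor
  · refine fun h y hy => (Orthogonal.trans (y := x) (b := P.nabla J a) ?_ h.symm).symm
    simp only [Orthogonal, compl_compl_eq']
    refine P.nabla_mono_set (fun i hi => ?_) _
    by_contra hc
    exact hi (hy i hc).symm
  · intro h
    obtain ⟨z, b⟩ := p
    choose g hg using fun t : X => exists_ne t
    -- This `J`-variant of `x` differs from `z` at every index of `J`, so its disagreement set with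
    -- `z` contains both `J` and that of `x`.
    have h' := (h (fun i => if i ∈ J then g (z i) else x i) fun i hi => by simp [hi]).symm
    refine Orthogonal.symm (le_trans ?_ h')
    rw [← nabla_union']
    refine P.nabla_mono_set ?_ _
    rintro i (hi | hi)
    · by_cases hJ : i ∈ J
      · simpa [hJ] using hg (z i)
      · simpa [hJ] using hi
    · simpa [hi] using hg (z i)

/-! ### The embedding into functions -/

variable (P)

/-- The element `a` of the copy of `A` indexed by `x`, in the completion of the glued copies. -/
def toConcept (a : A) (x : I → X) : Concept _ _ (P.Orthogonal X) where
  extent := {p | P.Orthogonal X p (x, aᶜ)}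
  intent := {p | P.Orthogonal X p (x, a)}
  upperPolar_extent := by
    ext q
    have := orthogonal_compl_iff (P := P) (p := q) (x := x) (a := aᶜ)
    rw [compl_compl_eq'] at this
    exact ⟨fun h => this.mpr fun p hp => (h hp).symm, fun h p hp => (this.mp h p hp).symm⟩
  lowerPolar_intent := Set.ext fun _ => orthogonal_compl_iff.symm

instance : CompleteOrtholattice (Concept _ _ (P.Orthogonal X)) :=
  conceptOrtholattice (fun _ _ => Orthogonal.symm) fun _ => Orthogonal.of_self

theorem toConcept_injective [Nonempty X] :
    Function.Injective (P.toConcept : A → (I → X) → Concept _ _ (P.Orthogonal X)) := by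
  have key : ∀ a b : A, (P.toConcept a : (I → X) → _) = P.toConcept b → a ≤ b := by
    intro a b h
    have x : I → X := Classical.arbitrary _
    have h1 : (x, a) ∈ (P.toConcept a x).extent :=
      orthogonal_same.mpr (compl_compl_eq' a).ge
    rw [h] at h1
    exact (orthogonal_same.mp h1).trans (compl_compl_eq' b).le
  exact fun a b h => le_antisymm (key a b h) (key b a h.symm)

theorem toConcept_compl (a : A) :
    (P.toConcept aᶜ : (I → X) → _) = (P.toConcept a)ᶜ :=
  funext fun _ => Concept.ext' (by simp only [toConcept]; rfl)

theorem toConcept_sup (a b : A) :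
    (P.toConcept (a ⊔ b) : (I → X) → _) = P.toConcept a ⊔ P.toConcept b :=
  funext fun _ => Concept.ext' (Set.ext fun _ => orthogonal_sup_iff)

theorem toConcept_inf (a b : A) :
    (P.toConcept (a ⊓ b) : (I → X) → _) = P.toConcept a ⊓ P.toConcept b := by
  rw [inf_eq_compl_sup a b, inf_eq_compl_sup (P.toConcept a), toConcept_compl, toConcept_sup,
    toConcept_compl, toConcept_compl]

theorem toConcept_bot : (P.toConcept ⊥ : (I → X) → _) = ⊥ :=
  funext fun x => Concept.ext' (Set.eq_univ_of_forall fun p =>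
    show P.Orthogonal X p (x, ⊥) from le_top.trans compl_bot'.ge)

theorem toConcept_top : (P.toConcept ⊤ : (I → X) → _) = ⊤ := by
  rw [← compl_bot', toConcept_compl, toConcept_bot, compl_bot']

/-- Intents reverse the order, so a join is tested by membership in all the intents, which is
`orthogonal_nabla_iff`. -/
theorem toConcept_nabla [Nontrivial X] (J : Set I) (a : A) :
    (P.toConcept (P.nabla J a) : (I → X) → _) = funNabla J (P.toConcept a) := by
  funext x
  refine le_antisymm (Concept.intent_subset_intent_iff.mp fun p hp => ?_)
    (funNabla_le fun y hy => Concept.intent_subset_intent_iff.mp fun p hp =>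
      orthogonal_nabla_iff.mp hp y hy)
  exact orthogonal_nabla_iff.mpr fun y hy =>
    Concept.intent_subset_intent_iff.mpr (le_funNabla (P.toConcept a) hy) hp

theorem IsSupport.independentOf_toConcept [Nontrivial X] {J : Set I} {a : A}
    (h : P.IsSupport J a) : IndependentOf (P.toConcept a : (I → X) → _) Jᶜ := by
  intro x y hxy
  -- The image of `a` is now a functional quantification over `Jᶜ`, hence constant on `Jᶜ`-variants.
  rw [← show P.nabla Jᶜ a = a from h, toConcept_nabla]
  exact funNabla_congr _ _ hxy

/-- The image of `A` in the functional polyadic ortholattice. -/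
def toConceptRange (X : Type w) [Nontrivial X] :
    (fullFunctional I X (Concept _ _ (P.Orthogonal X))).Subalg where
  carrier := Set.range P.toConcept
  inf_mem := by rintro _ _ ⟨a, rfl⟩ ⟨b, rfl⟩; exact ⟨_, P.toConcept_inf a b⟩
  sup_mem := by rintro _ _ ⟨a, rfl⟩ ⟨b, rfl⟩; exact ⟨_, P.toConcept_sup a b⟩
  compl_mem := by rintro _ ⟨a, rfl⟩; exact ⟨_, P.toConcept_compl a⟩
  bot_mem := ⟨_, P.toConcept_bot⟩
  top_mem := ⟨_, P.toConcept_top⟩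
  nabla_mem J := by rintro _ ⟨a, rfl⟩; exact ⟨_, P.toConcept_nabla J a⟩

/-- The isomorphism of `A` onto its image in the functional polyadic ortholattice. -/
noncomputable def isoToConceptRange (X : Type w) [Nontrivial X] :
    P.Iso (P.toConceptRange X).toPolyadic where
  toEquiv := Equiv.ofInjective _ P.toConcept_injective
  map_inf a b := Subtype.ext (P.toConcept_inf a b)
  map_sup a b := Subtype.ext (P.toConcept_sup a b)
  map_compl a := Subtype.ext (P.toConcept_compl a)
  map_bot := Subtype.ext P.toConcept_bot
  map_top := Subtype.ext P.toConcept_top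
  map_nabla J a := Subtype.ext (P.toConcept_nabla J a)

end Polyadic

end Ortholattice

theorem mainTheorem3 {I : Type v} {A : Type u} [Ortholattice A]
    (P : Ortholattice.Polyadic I A) (hP : P.LocallyFinite) :
    ∃ (C : Type (max u v)) (_ : CompleteOrtholattice C) (X : Type (max u v)) (_ : Nonempty X)
      (S : (Ortholattice.fullFunctional I X C).Subalg),
      S.carrier ⊆ (Ortholattice.fullLocallyFinite I X C).carrier ∧
        Nonempty (P.Iso S.toPolyadic) := by
  -- Two points suffice; the lift only adjusts the universe.
  let X : Type (max u v) := ULift Bool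
  refine ⟨Concept _ _ (P.Orthogonal X), inferInstance, X, inferInstance, P.toConceptRange X, ?_,
    ⟨P.isoToConceptRange X⟩⟩
  rintro _ ⟨a, rfl⟩
  obtain ⟨J, hJ, h⟩ := hP a
  exact ⟨J, hJ, h.independentOf_toConcept⟩
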